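/- Let $\Sigma=\biguplus_{n\ge 0}\Sigma_n$ be a topological signature (each set $\Sigma_n$ of $n$-ary operation symbols is a topological space) that is at most unary, that is, $\Sigma_n=\emptyset$ for all $n\ge 2$, and let $X$ be an arbitrary topological space. A topological $\Sigma$-algebra is a topological space $S$ with jointly continuous evaluation maps $\Sigma_n\times S^n\to S$, $(w,s_1,\dots,s_n)\mapsto w_S(s_1,\dots,s_n)$; it is profinite if it is compact Hausdorff and any two distinct points are separated by a continuous homomorphism into a finite discrete topological $\Sigma$-algebra. Profinite monoids are defined in the same way. Let $\iota:X\to\overline{\Omega}_X\mathsf{Fin}_\Sigma$ be the free profinite $\Sigma$-algebra over $X$: every continuous map $\varphi$ from $X$ into a profinite $\Sigma$-algebra $S$ is $\hat\varphi\circ\iota$ for a unique continuous homomorphism $\hat\varphi:\overline{\Omega}_X\mathsf{Fin}_\Sigma\to S$. Let $\eta:X\uplus\Sigma\to\overline{\Omega}_{X\cup\Sigma}\mathsf{M}$ be the free profinite monoid over the topological disjoint union of $X$ and all the $\Sigma_n$, and make it a $\Sigma$-algebra by letting $w\in\Sigma_n$ act by $(m_1,\dots,m_n)\mapsto \eta(w)\,m_1\cdots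 m_n$. Let $S_{\mathsf M}$ be its closed subalgebra generated by $\eta(X)$, which is a profinite $\Sigma$-algebra, and let the Polish representation $\Phi_X:\overline{\Omega}_X\mathsf{Fin}_\Sigma\to S_{\mathsf M}$ be the unique continuous homomorphism of $\Sigma$-algebras with $\Phi_X(\iota(x))=\eta(x)$ for all $x\in X$. Then $\Phi_X$ is an isomorphism of topological algebras, that is, a homomorphism of $\Sigma$-algebras that is a homeomorphism. (In the degenerate case $X=\Sigma_0=\emptyset$ both algebras are taken to be empty.) -/

import Mathlib

open Set Topology

universe u v w

namespace UnivAlg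

/-! A signature is a family `Sg : ℕ → Type u`, where `Sg n` is the set of `n`-ary operation symbols.
It is a topological signature when every `Sg n` carries a topology. -/

/-- An algebra structure of signature `Sg` on `S`: evaluation maps `Sg n × S ^ n → S`. -/
class Alg (Sg : ℕ → Type u) (S : Type v) where
  eval : ∀ n : ℕ, Sg n → (Fin n → S) → S

/-- The evaluation maps are jointly continuous in the symbol and the arguments, that is,
`S` is a topological algebra over the topological signature `Sg`. -/
def ContinuousEval (Sg : ℕ → Type u) [∀ n, TopologicalSpace (Sg n)]
    (S : Type v) [TopologicalSpace S] [Alg Sg S] : Prop :=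
  ∀ n : ℕ, Continuous (fun p : Sg n × (Fin n → S) => Alg.eval n p.1 p.2)

/-- Homomorphisms of `Sg`-algebras. -/
def IsHom (Sg : ℕ → Type u) {S : Type v} {T : Type w} [Alg Sg S] [Alg Sg T] (f : S → T) : Prop :=
  ∀ (n : ℕ) (c : Sg n) (s : Fin n → S), f (Alg.eval n c s) = Alg.eval n c (fun j => f (s j))

/-- Isomorphisms of topological algebras: homomorphisms that are homeomorphisms
(the inverse map is then automatically a homomorphism). -/
structure IsTopAlgIso (Sg : ℕ → Type u) {S : Type v} {T : Type w} [TopologicalSpace S]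
    [TopologicalSpace T] [Alg Sg S] [Alg Sg T] (f : S → T) : Prop where
  isHom : IsHom Sg f
  isHomeomorph : IsHomeomorph f

/-- Subsets closed under all operations. -/
def IsSubalgebra (Sg : ℕ → Type u) {S : Type v} [Alg Sg S] (C : Set S) : Prop :=
  ∀ (n : ℕ) (c : Sg n) (s : Fin n → S), (∀ j, s j ∈ C) → Alg.eval n c s ∈ C

/-- The closed subalgebra generated by a subset `A` of a topological algebra. -/
def closedSubalgebra (Sg : ℕ → Type u) {S : Type v} [TopologicalSpace S] [Alg Sg S]
    (A : Set S) : Set S :=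
  ⋂₀ {C : Set S | IsClosed C ∧ IsSubalgebra Sg C ∧ A ⊆ C}

/-- Profinite algebras: compact Hausdorff topological algebras in which any two distinct points
are separated by a continuous homomorphism into a finite (discrete topological) algebra.
Up to isomorphism the finite algebra lives in the lowest universe. -/
structure IsProfinite (Sg : ℕ → Type u) [∀ n, TopologicalSpace (Sg n)]
    (S : Type v) [TopologicalSpace S] [Alg Sg S] : Prop where
  compact : CompactSpace S
  t2 : T2Space S
  continuousEval : ContinuousEval Sg S
  residuallyFinite : ∀ s s' : S, s ≠ s' →
    ∃ (T : Type) (_ : Finite T) (_ : TopologicalSpace T) (_ : DiscreteTopology T) (_ : Alg Sg T),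
      ContinuousEval Sg T ∧ ∃ f : S → T, Continuous f ∧ IsHom Sg f ∧ f s ≠ f s'

section Closed

variable {Sg : ℕ → Type u} {S : Type v} [TopologicalSpace S] [Alg Sg S]

theorem isClosed_closedSubalgebra (A : Set S) : IsClosed (closedSubalgebra Sg A) :=
  isClosed_sInter fun _ hC => hC.1

theorem isSubalgebra_closedSubalgebra (A : Set S) : IsSubalgebra Sg (closedSubalgebra Sg A) :=
  fun n c s hs C hC => hC.2.1 n c s fun j => hs j C hC

theorem subset_closedSubalgebra (A : Set S) : A ⊆ closedSubalgebra Sg A :=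
  fun _ ha _ hC => hC.2.2 ha

/-- The closed subalgebra generated by `A`, as an algebra in its own right. -/
instance closedSubalgebraAlg (A : Set S) : Alg Sg (closedSubalgebra Sg A) where
  eval n c s := ⟨Alg.eval n c fun j => (s j : S),
    isSubalgebra_closedSubalgebra A n c _ fun j => (s j).2⟩

theorem mem_of_closedSubalgebra {A : Set S} (C : Set (closedSubalgebra Sg A))
    (hC : IsClosed C) (hs : IsSubalgebra Sg C)
    (hA : ∀ (a : S) (ha : a ∈ A), (⟨a, subset_closedSubalgebra A ha⟩ : closedSubalgebra Sg A) ∈ C)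
    (x : closedSubalgebra Sg A) : x ∈ C := by
  have h : (x : S) ∈ ((↑) '' C : Set S) := by
    refine x.2 _ ⟨(isClosed_closedSubalgebra (Sg := Sg) A).isClosedEmbedding_subtypeVal.isClosedMap _ hC, ?_,
      fun a ha => ⟨_, hA a ha, rfl⟩⟩
    intro n c s hs'
    choose t ht hts using hs'
    refine ⟨Alg.eval n c t, hs n c t ht, ?_⟩
    have : s = fun j => (t j : S) := funext fun j => (hts j).symm
    rw [this]
    rfl
  obtain ⟨y, hy, hyx⟩ := h
  rwa [← Subtype.ext hyx]

theorem IsProfinite.closedSubalg [∀ n, TopologicalSpace (Sg n)] (h : IsProfinite Sg S)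
    (A : Set S) : IsProfinite Sg (closedSubalgebra Sg A) where
  compact := by
    have := h.compact
    exact isCompact_iff_compactSpace.mp (isClosed_closedSubalgebra (Sg := Sg) A).isCompact
  t2 := by
    have := h.t2
    infer_instance
  continuousEval n := by
    refine Continuous.subtype_mk ((h.continuousEval n).comp
      (f := fun p : Sg n × (Fin n → closedSubalgebra Sg A) => (p.1, fun j => (p.2 j : S))) ?_) _
    fun_prop
  residuallyFinite s s' hss := by
    obtain ⟨T, i1, i2, i3, i4, hT, f, hf, hh, hne⟩ :=
      h.residuallyFinite s s' fun e => hss (Subtype.ext e)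
    exact ⟨T, i1, i2, i3, i4, hT, fun x => f x, hf.comp continuous_subtype_val,
      fun n c t => hh n c fun j => (t j : S), hne⟩

end Closed

section Free

variable (Sg : ℕ → Type u) [∀ n, TopologicalSpace (Sg n)] (X : Type v) [TopologicalSpace X]

/-- A finite discrete topological `Sg`-algebra, on the set `{0, …, k}`, with a continuous map
from `X` into it. Every such pair is isomorphic to one of these. -/
structure FinPoint where
  k : ℕ
  alg : Alg Sg (Fin (k + 1))
  continuousEval : ContinuousEval Sg (Fin (k + 1))
  map : X → Fin (k + 1)
  continuous_map : Continuous map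

variable {Sg X}

def FinPoint.Carrier (i : FinPoint Sg X) : Type := Fin (i.k + 1)

instance (i : FinPoint Sg X) : TopologicalSpace i.Carrier :=
  inferInstanceAs (TopologicalSpace (Fin (i.k + 1)))
instance (i : FinPoint Sg X) : DiscreteTopology i.Carrier :=
  inferInstanceAs (DiscreteTopology (Fin (i.k + 1)))
instance (i : FinPoint Sg X) : Finite i.Carrier := inferInstanceAs (Finite (Fin (i.k + 1)))
instance (i : FinPoint Sg X) : Alg Sg i.Carrier := i.alg

theorem FinPoint.continuousEval_carrier (i : FinPoint Sg X) : ContinuousEval Sg i.Carrier :=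
  i.continuousEval

/-- Products carry the componentwise operations. -/
instance (ι : Type w) (S : ι → Type v) [∀ i, Alg Sg (S i)] : Alg Sg (∀ i, S i) where
  eval n c s := fun i => Alg.eval n c fun j => s j i

/-- Binary products carry the componentwise operations. -/
instance (S : Type v) (T : Type w) [Alg Sg S] [Alg Sg T] : Alg Sg (S × T) where
  eval n c s := (Alg.eval n c fun j => (s j).1, Alg.eval n c fun j => (s j).2)

variable (Sg X)

/-- The map from `X` to the product of all finite algebras under `X`. -/
def toProd (x : X) (i : FinPoint Sg X) : i.Carrier := i.map x

/-- The free profinite `Sg`-algebra on the topological space `X`: the closed subalgebra generated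
by `X` in the product of all finite algebras under `X`. -/
def FreeProfinite : Type (max u v) :=
  closedSubalgebra Sg (S := ∀ i : FinPoint Sg X, i.Carrier) (range (toProd Sg X))

namespace FreeProfinite

instance : TopologicalSpace (FreeProfinite Sg X) :=
  inferInstanceAs (TopologicalSpace (closedSubalgebra Sg (range (toProd Sg X))))

instance : Alg Sg (FreeProfinite Sg X) :=
  inferInstanceAs (Alg Sg (closedSubalgebra Sg (range (toProd Sg X))))

/-- The canonical generating map of the free profinite algebra. -/
def ι (x : X) : FreeProfinite Sg X := ⟨toProd Sg X x, subset_closedSubalgebra _ ⟨x, rfl⟩⟩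

theorem continuous_ι : Continuous (ι Sg X) :=
  Continuous.subtype_mk (continuous_pi fun i => i.continuous_map) _

theorem isProfinite_prod : IsProfinite Sg (∀ i : FinPoint Sg X, i.Carrier) where
  compact := inferInstance
  t2 := inferInstance
  continuousEval n := continuous_pi fun i => (i.continuousEval_carrier n).comp
    (g := fun p : Sg n × (Fin n → i.Carrier) => Alg.eval n p.1 p.2)
    (f := fun p : Sg n × (Fin n → ∀ i : FinPoint Sg X, i.Carrier) => (p.1, fun j => p.2 j i))
    (by fun_prop)
  residuallyFinite s s' h := by
    obtain ⟨i, hi⟩ := Function.ne_iff.mp h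
    exact ⟨i.Carrier, inferInstance, inferInstance, inferInstance, inferInstance,
      i.continuousEval_carrier, fun x => x i, continuous_apply i, fun _ _ _ => rfl, hi⟩

theorem isProfinite : IsProfinite Sg (FreeProfinite Sg X) :=
  (isProfinite_prod Sg X).closedSubalg _

variable {Sg X}

theorem mem_of_isClosed (C : Set (FreeProfinite Sg X)) (hC : IsClosed C) (hs : IsSubalgebra Sg C)
    (hX : ∀ x, ι Sg X x ∈ C) (y : FreeProfinite Sg X) : y ∈ C :=
  mem_of_closedSubalgebra C hC hs (by rintro _ ⟨x, rfl⟩; exact hX x) y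

/-- The coordinate of the free profinite algebra at a given finite algebra under `X`. -/
def coord (i : FinPoint Sg X) (y : FreeProfinite Sg X) : i.Carrier := y.1 i

theorem continuous_coord (i : FinPoint Sg X) : Continuous (coord i) :=
  (continuous_apply i).comp continuous_subtype_val

theorem isHom_coord (i : FinPoint Sg X) : IsHom Sg (coord i) := fun _ _ _ => rfl

/-- A continuous map from `X` into a finite algebra factors through the free profinite algebra. -/
theorem exists_hom_finite {T : Type} [Finite T] [TopologicalSpace T] [DiscreteTopology T]
    [Alg Sg T] (hT : ContinuousEval Sg T) (t₀ : T) (φ : X → T) (hφ : Continuous φ) :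
    ∃ f : FreeProfinite Sg X → T, Continuous f ∧ IsHom Sg f ∧ ∀ x, f (ι Sg X x) = φ x := by
  obtain ⟨n, ⟨e⟩⟩ := Finite.exists_equiv_fin T
  obtain _ | k := n
  · exact (e t₀).elim0
  let A : Alg Sg (Fin (k + 1)) := ⟨fun n c s => e (Alg.eval n c fun j => e.symm (s j))⟩
  have he : Continuous e := continuous_of_discreteTopology
  have he' : Continuous e.symm := continuous_of_discreteTopology
  let i : FinPoint Sg X :=
    { k := k
      alg := A
      continuousEval := fun n => he.comp ((hT n).comp
        (f := fun p : Sg n × (Fin n → Fin (k + 1)) => (p.1, fun j => e.symm (p.2 j)))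
        (by fun_prop))
      map := fun x => e (φ x)
      continuous_map := he.comp hφ }
  refine ⟨fun y => e.symm (coord i y), he'.comp (continuous_coord i), fun n c s => ?_, fun x => ?_⟩
  · exact e.symm_apply_apply _
  · exact e.symm_apply_apply _

/-- The universal property of the free profinite algebra. -/
theorem existsUnique_lift {S : Type w} [TopologicalSpace S] [Alg Sg S] (hS : IsProfinite Sg S)
    (φ : X → S) (hφ : Continuous φ) :
    ∃! f : FreeProfinite Sg X → S, Continuous f ∧ IsHom Sg f ∧ ∀ x, f (ι Sg X x) = φ x := by
  have hc := hS.compact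
  have ht := hS.t2
  have hc' := (isProfinite Sg X).compact
  have ht' := (isProfinite Sg X).t2
  have huniq : ∀ (T : Type w) [TopologicalSpace T] [T2Space T] [Alg Sg T]
      (f g : FreeProfinite Sg X → T), Continuous f → Continuous g → IsHom Sg f → IsHom Sg g →
      (∀ x, f (ι Sg X x) = g (ι Sg X x)) → f = g := by
    intro T _ _ _ f g hf hg hf' hg' h
    refine funext fun y => mem_of_isClosed {y | f y = g y} (isClosed_eq hf hg) ?_ h y
    intro n c s hs
    change f _ = g _
    rw [hf', hg']
    exact congrArg _ (funext hs)
  refine existsUnique_of_exists_of_unique ?_ ?_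
  · let G : Set (FreeProfinite Sg X × S) :=
      closedSubalgebra Sg (range fun x => (ι Sg X x, φ x))
    have hGc : IsClosed G := isClosed_closedSubalgebra _
    have hGs : IsSubalgebra Sg G := isSubalgebra_closedSubalgebra _
    have hGg : ∀ x, (ι Sg X x, φ x) ∈ G := fun x => subset_closedSubalgebra _ ⟨x, rfl⟩
    have hsurj : ∀ y, ∃ s, (y, s) ∈ G := by
      intro y
      have : y ∈ Prod.fst '' G := by
        refine mem_of_isClosed _ (isClosedMap_fst_of_compactSpace _ hGc) ?_
          (fun x => ⟨_, hGg x, rfl⟩) y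
        intro n c s hs
        choose t ht hts using hs
        refine ⟨Alg.eval n c t, hGs n c t ht, ?_⟩
        change Alg.eval n c (fun j => (t j).1) = _
        exact congrArg _ (funext hts)
      obtain ⟨⟨a, s⟩, h, rfl⟩ := this
      exact ⟨s, h⟩
    have hinj : ∀ y s s', (y, s) ∈ G → (y, s') ∈ G → s = s' := by
      intro y s s' h h'
      by_contra hne
      obtain ⟨T, _, _, _, _, hT, θ, hθ, hθ', hθne⟩ := hS.residuallyFinite s s' hne
      obtain ⟨f, hf, hf', hfx⟩ := exists_hom_finite hT (θ s) (fun x => θ (φ x)) (hθ.comp hφ)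
      have key : G ⊆ {p | f p.1 = θ p.2} := by
        refine sInter_subset_of_mem ⟨isClosed_eq (by fun_prop) (by fun_prop), ?_, ?_⟩
        · intro n c t ht
          change f (Alg.eval n c fun j => (t j).1) = θ (Alg.eval n c fun j => (t j).2)
          rw [hf', hθ']
          exact congrArg _ (funext ht)
        · rintro _ ⟨x, rfl⟩
          exact hfx x
      exact hθne ((key h).symm.trans (key h'))
    choose f hf using hsurj
    refine ⟨f, ?_, ?_, ?_⟩
    · rw [continuous_iff_isClosed]
      intro C hC
      have : f ⁻¹' C = Prod.fst '' (G ∩ Prod.snd ⁻¹' C) := by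
        ext y
        constructor
        · exact fun h => ⟨(y, f y), ⟨hf y, h⟩, rfl⟩
        · rintro ⟨⟨y, s⟩, ⟨h, hs⟩, rfl⟩
          have := hinj _ _ _ (hf y) h
          simpa [this] using hs
      rw [this]
      exact isClosedMap_fst_of_compactSpace _ (hGc.inter (hC.preimage continuous_snd))
    · intro n c s
      exact hinj _ _ _ (hf _) (hGs n c (fun j => (s j, f (s j))) fun j => hf _)
    · intro x
      exact hinj _ _ _ (hf _) (hGg x)
  · rintro f g ⟨hf, hf', hfx⟩ ⟨hg, hg', hgx⟩
    exact huniq S f g hf hg hf' hg' fun x => (hfx x).trans (hgx x).symm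

/-- The continuous homomorphism induced by a continuous map into a profinite algebra. -/
noncomputable def lift {S : Type w} [TopologicalSpace S] [Alg Sg S] (hS : IsProfinite Sg S)
    (φ : X → S) (hφ : Continuous φ) : FreeProfinite Sg X → S :=
  (existsUnique_lift hS φ hφ).choose

theorem lift_spec {S : Type w} [TopologicalSpace S] [Alg Sg S] (hS : IsProfinite Sg S)
    (φ : X → S) (hφ : Continuous φ) : Continuous (lift hS φ hφ) ∧ IsHom Sg (lift hS φ hφ) ∧
      ∀ x, lift hS φ hφ (ι Sg X x) = φ x :=
  (existsUnique_lift hS φ hφ).choose_spec.1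

end FreeProfinite

end Free

section Monoids

/-- Profinite monoids: compact Hausdorff topological monoids in which any two distinct points
are separated by a continuous homomorphism into a finite discrete monoid. -/
structure IsProfiniteMonoid (M : Type v) [Monoid M] [TopologicalSpace M] : Prop where
  compact : CompactSpace M
  t2 : T2Space M
  continuousMul : ContinuousMul M
  residuallyFinite : ∀ s s' : M, s ≠ s' →
    ∃ (T : Type) (_ : Finite T) (_ : TopologicalSpace T) (_ : DiscreteTopology T) (_ : Monoid T)
      (f : M →* T), Continuous f ∧ f s ≠ f s'

variable (Y : Type v) [TopologicalSpace Y]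

/-- A finite discrete monoid, on the set `{0, …, k}`, with a continuous map from `Y` into it.
Every such pair is isomorphic to one of these. -/
structure FinMonoidPoint where
  k : ℕ
  monoid : Monoid (Fin (k + 1))
  map : Y → Fin (k + 1)
  continuous_map : Continuous map

variable {Y}

/-- The underlying set of the finite monoid (with the given multiplication, not that of `Fin`). -/
def FinMonoidPoint.Carrier (i : FinMonoidPoint Y) : Type := Fin (i.k + 1)

instance (i : FinMonoidPoint Y) : TopologicalSpace i.Carrier :=
  inferInstanceAs (TopologicalSpace (Fin (i.k + 1)))
instance (i : FinMonoidPoint Y) : DiscreteTopology i.Carrier :=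
  inferInstanceAs (DiscreteTopology (Fin (i.k + 1)))
instance (i : FinMonoidPoint Y) : Finite i.Carrier := inferInstanceAs (Finite (Fin (i.k + 1)))
instance (i : FinMonoidPoint Y) : Monoid i.Carrier := i.monoid

variable (Y)

/-- The map from `Y` to the product of all finite monoids under `Y`. -/
def toMonoidProd (y : Y) (i : FinMonoidPoint Y) : i.Carrier := i.map y

/-- The closed submonoid generated by `Y` in the product of all finite monoids under `Y`. -/
def freeProfiniteSubmonoid : Submonoid (∀ i : FinMonoidPoint Y, i.Carrier) :=
  (Submonoid.closure (range (toMonoidProd Y))).topologicalClosure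

/-- The free profinite monoid on the topological space `Y`. -/
def FreeProfiniteMonoid : Type v := freeProfiniteSubmonoid Y

namespace FreeProfiniteMonoid

instance : TopologicalSpace (FreeProfiniteMonoid Y) :=
  inferInstanceAs (TopologicalSpace (freeProfiniteSubmonoid Y))

instance : Monoid (FreeProfiniteMonoid Y) := inferInstanceAs (Monoid (freeProfiniteSubmonoid Y))

instance : ContinuousMul (FreeProfiniteMonoid Y) :=
  inferInstanceAs (ContinuousMul (freeProfiniteSubmonoid Y))

/-- The canonical generating map of the free profinite monoid. -/
def η (y : Y) : FreeProfiniteMonoid Y :=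
  ⟨toMonoidProd Y y, Submonoid.le_topologicalClosure _ (Submonoid.subset_closure ⟨y, rfl⟩)⟩

theorem continuous_η : Continuous (η Y) :=
  Continuous.subtype_mk (continuous_pi fun i => i.continuous_map) _

variable {Y}

/-- The coordinate of the free profinite monoid at a given finite monoid under `Y`. -/
def coord (i : FinMonoidPoint Y) : FreeProfiniteMonoid Y →* i.Carrier :=
  (Pi.evalMonoidHom (fun i : FinMonoidPoint Y => i.Carrier) i).comp (freeProfiniteSubmonoid Y).subtype

theorem continuous_coord (i : FinMonoidPoint Y) : Continuous (coord i) :=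
  (continuous_apply i).comp continuous_subtype_val

variable (Y)

theorem isProfiniteMonoid : IsProfiniteMonoid (FreeProfiniteMonoid Y) where
  compact := isCompact_iff_compactSpace.mp
    (Submonoid.isClosed_topologicalClosure
      (Submonoid.closure (range (toMonoidProd Y)))).isCompact
  t2 := inferInstanceAs (T2Space (freeProfiniteSubmonoid Y))
  continuousMul := inferInstance
  residuallyFinite s s' h := by
    obtain ⟨i, hi⟩ := Function.ne_iff.mp fun e => h (Subtype.ext e)
    exact ⟨i.Carrier, inferInstance, inferInstance, inferInstance, inferInstance, coord i,
      continuous_coord i, hi⟩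

variable {Y}

theorem mem_of_isClosed (C : Submonoid (FreeProfiniteMonoid Y))
    (hC : IsClosed (C : Set (FreeProfiniteMonoid Y))) (hY : ∀ y, η Y y ∈ C)
    (z : FreeProfiniteMonoid Y) : z ∈ C := by
  have hcl : IsClosed (freeProfiniteSubmonoid Y : Set (∀ i : FinMonoidPoint Y, i.Carrier)) :=
    Submonoid.isClosed_topologicalClosure _
  let D : Submonoid (∀ i : FinMonoidPoint Y, i.Carrier) := C.map (freeProfiniteSubmonoid Y).subtype
  have hD : IsClosed (D : Set (∀ i : FinMonoidPoint Y, i.Carrier)) :=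
    hcl.isClosedEmbedding_subtypeVal.isClosedMap _ hC
  have h : freeProfiniteSubmonoid Y ≤ D := by
    refine Submonoid.topologicalClosure_minimal _ (Submonoid.closure_le.mpr ?_) hD
    rintro _ ⟨y, rfl⟩
    exact ⟨η Y y, hY y, rfl⟩
  obtain ⟨y, hy, hyz⟩ := h z.2
  rwa [← Subtype.ext hyz]

/-- A continuous map from `Y` into a finite monoid factors through the free profinite monoid. -/
theorem exists_hom_finite {T : Type} [Finite T] [TopologicalSpace T] [DiscreteTopology T]
    [Monoid T] (φ : Y → T) (hφ : Continuous φ) :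
    ∃ f : FreeProfiniteMonoid Y →* T, Continuous f ∧ ∀ y, f (η Y y) = φ y := by
  obtain ⟨n, ⟨e⟩⟩ := Finite.exists_equiv_fin T
  obtain _ | k := n
  · exact (e 1).elim0
  let A : Monoid (Fin (k + 1)) := e.symm.monoid
  let i : FinMonoidPoint Y :=
    { k := k
      monoid := A
      map := fun x => e (φ x)
      continuous_map := (continuous_of_discreteTopology (f := e)).comp hφ }
  let g : i.Carrier →* T :=
    { toFun := e.symm
      map_one' := e.symm_apply_apply _
      map_mul' := fun _ _ => e.symm_apply_apply _ }
  have hg : Continuous g := continuous_of_discreteTopology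
  exact ⟨g.comp (coord i), hg.comp (continuous_coord i), fun y => e.symm_apply_apply _⟩

/-- The universal property of the free profinite monoid. -/
theorem existsUnique_lift {M : Type w} [TopologicalSpace M] [Monoid M] (hM : IsProfiniteMonoid M)
    (φ : Y → M) (hφ : Continuous φ) :
    ∃! f : FreeProfiniteMonoid Y →* M, Continuous f ∧ ∀ y, f (η Y y) = φ y := by
  have hc := hM.compact
  have ht := hM.t2
  have hm := hM.continuousMul
  have hc' := (isProfiniteMonoid Y).compact
  have ht' := (isProfiniteMonoid Y).t2
  refine existsUnique_of_exists_of_unique ?_ ?_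
  · let G : Submonoid (FreeProfiniteMonoid Y × M) :=
      (Submonoid.closure (range fun y => (η Y y, φ y))).topologicalClosure
    have hGc : IsClosed (G : Set (FreeProfiniteMonoid Y × M)) :=
      Submonoid.isClosed_topologicalClosure _
    have hGg : ∀ y, (η Y y, φ y) ∈ G := fun y =>
      Submonoid.le_topologicalClosure _ (Submonoid.subset_closure ⟨y, rfl⟩)
    have hsurj : ∀ z, ∃ s, (z, s) ∈ G := by
      intro z
      have : z ∈ G.map (MonoidHom.fst _ _) :=
        mem_of_isClosed _ (isClosedMap_fst_of_compactSpace _ hGc) (fun y => Submonoid.mem_map.mpr ⟨_, hGg y, rfl⟩) z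
      obtain ⟨⟨a, s⟩, h, rfl⟩ := this
      exact ⟨s, h⟩
    have hinj : ∀ y s s', (y, s) ∈ G → (y, s') ∈ G → s = s' := by
      intro y s s' h h'
      by_contra hne
      obtain ⟨T, _, _, _, _, θ, hθ, hθne⟩ := hM.residuallyFinite s s' hne
      obtain ⟨f, hf, hfx⟩ := exists_hom_finite (fun y => θ (φ y)) (hθ.comp hφ)
      let E : Submonoid (FreeProfiniteMonoid Y × M) :=
        MonoidHom.eqLocusM (f.comp (MonoidHom.fst _ _)) (θ.comp (MonoidHom.snd _ _))
      have key : G ≤ E := by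
        refine Submonoid.topologicalClosure_minimal _ (Submonoid.closure_le.mpr ?_)
          (isClosed_eq (hf.comp continuous_fst) (hθ.comp continuous_snd))
        rintro _ ⟨x, rfl⟩
        exact hfx x
      have h1 : f y = θ s := key h
      have h2 : f y = θ s' := key h'
      exact hθne (h1.symm.trans h2)
    choose f hf using hsurj
    refine ⟨⟨⟨f, hinj _ _ _ (hf _) G.one_mem⟩, fun a b => hinj _ _ _ (hf _)
      (G.mul_mem (hf a) (hf b))⟩, ?_, fun y => hinj _ _ _ (hf _) (hGg y)⟩
    change Continuous f
    rw [continuous_iff_isClosed]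
    intro C hC
    have : f ⁻¹' C = Prod.fst '' ((G : Set (FreeProfiniteMonoid Y × M)) ∩ Prod.snd ⁻¹' C) := by
      ext y
      constructor
      · exact fun h => ⟨(y, f y), ⟨hf y, h⟩, rfl⟩
      · rintro ⟨⟨y, s⟩, ⟨h, hs⟩, rfl⟩
        have := hinj _ _ _ (hf y) h
        simpa [this] using hs
    rw [this]
    exact isClosedMap_fst_of_compactSpace _ (hGc.inter (hC.preimage continuous_snd))
  · rintro f g ⟨hf, hfx⟩ ⟨hg, hgx⟩
    refine MonoidHom.ext fun z => mem_of_isClosed (MonoidHom.eqLocusM f g) (isClosed_eq hf hg)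
      (fun y => (hfx y).trans (hgx y).symm) z

end FreeProfiniteMonoid

end Monoids

section Polish

/-- The algebra structure `κ_γ(M)` on a monoid `M` determined by a map `γ` from the signature
to `M`: the symbol `c` of arity `n` acts by `(m₁, …, mₙ) ↦ γ(c) m₁ ⋯ mₙ`. -/
@[reducible] def kappa {Sg : ℕ → Type u} {M : Type v} [Monoid M] (γ : (n : ℕ) → Sg n → M) :
    Alg Sg M where
  eval n c m := γ n c * (List.ofFn m).prod

variable (Sg : ℕ → Type u) [∀ n, TopologicalSpace (Sg n)] (X : Type v) [TopologicalSpace X]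

/-- The alphabet `X ∪ Σ`: the topological disjoint union of `X` and all the `Σ_n`. -/
abbrev Alphabet : Type (max u v) := X ⊕ (Σ n : ℕ, Sg n)

/-- The free profinite monoid on `X ∪ Σ`, as a `Σ`-algebra. -/
instance freeProfiniteMonoidAlg : Alg Sg (FreeProfiniteMonoid (Alphabet Sg X)) :=
  kappa fun n c => FreeProfiniteMonoid.η (Alphabet Sg X) (Sum.inr ⟨n, c⟩)

theorem isProfinite_freeProfiniteMonoid :
    IsProfinite Sg (FreeProfiniteMonoid (Alphabet Sg X)) where
  compact := (FreeProfiniteMonoid.isProfiniteMonoid _).compact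
  t2 := (FreeProfiniteMonoid.isProfiniteMonoid _).t2
  continuousEval n := by
    refine Continuous.mul ((FreeProfiniteMonoid.continuous_η _).comp ?_) ?_
    · fun_prop
    · simp only [List.ofFn_eq_map]
      exact continuous_list_prod _ fun j _ => (continuous_apply j).comp continuous_snd
  residuallyFinite s s' h := by
    obtain ⟨T, i1, i2, i3, i4, f, hf, hne⟩ :=
      (FreeProfiniteMonoid.isProfiniteMonoid (Alphabet Sg X)).residuallyFinite s s' h
    refine ⟨T, i1, i2, i3,
      kappa fun n c => f (FreeProfiniteMonoid.η (Alphabet Sg X) (Sum.inr ⟨n, c⟩)), ?_, f, hf, ?_, hne⟩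
    · intro n
      refine Continuous.mul (hf.comp ((FreeProfiniteMonoid.continuous_η _).comp ?_)) ?_
      · fun_prop
      · exact (continuous_of_discreteTopology (f := fun m : Fin n → T => (List.ofFn m).prod)).comp
          continuous_snd
    · intro n c m
      change f (_ * (List.ofFn m).prod) = _ * (List.ofFn fun j => f (m j)).prod
      rw [map_mul, map_list_prod, List.map_ofFn]
      rfl

/-- The closed subalgebra `S_M` generated by `X` in the free profinite monoid on `X ∪ Σ`. -/
abbrev PolishAlgebra : Type (max u v) :=
  closedSubalgebra Sg (range fun x : X => FreeProfiniteMonoid.η (Alphabet Sg X) (Sum.inl x))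

theorem isProfinite_polishAlgebra : IsProfinite Sg (PolishAlgebra Sg X) :=
  (isProfinite_freeProfiniteMonoid Sg X).closedSubalg _

/-- The letter `x ∈ X`, as an element of `S_M`. -/
def polishLetter (x : X) : PolishAlgebra Sg X :=
  ⟨FreeProfiniteMonoid.η (Alphabet Sg X) (Sum.inl x), subset_closedSubalgebra _ ⟨x, rfl⟩⟩

theorem continuous_polishLetter : Continuous (polishLetter Sg X) :=
  Continuous.subtype_mk ((FreeProfiniteMonoid.continuous_η _).comp continuous_inl) _

/-- The Polish representation: the unique continuous homomorphism from the free profinite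
`Σ`-algebra on `X` to `S_M` that sends each generator `x` to the letter `x`. -/
noncomputable def polishRepresentation : FreeProfinite Sg X → PolishAlgebra Sg X :=
  FreeProfinite.lift (isProfinite_polishAlgebra Sg X) (polishLetter Sg X)
    (continuous_polishLetter Sg X)

end Polish

end UnivAlg

namespace UnivAlg

/-! A continuous bijection from a compact space to a Hausdorff space is a homeomorphism, so
bijectivity is all that is needed. Surjectivity holds for every signature: the image is compact,
hence a closed subalgebra, and it contains the generators of `PolishAlgebra`.

Injectivity is where the arity bound enters. Points of the free profinite algebra are separated by
its coordinates at finite algebras `T` under `X`, so it suffices that each coordinate factors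
through the Polish representation. Let words act on `T`: a letter of `X` acts by a constant map, a
nullary symbol likewise, a unary symbol by its operation. This is a continuous map from the alphabet
to the finite monoid of self-maps of `T`, so it extends to the free profinite monoid. Evaluating the
resulting self-maps at a fixed point of `T` is a homomorphism of algebras, because composing with a
unary operation and then evaluating is the same as applying the operation to the value
(`exists_hom_polishAlgebra`). With two or more arguments this breaks down: every argument of the
operation would receive the value of one and the same composite. By `FreeProfinite.hom_ext`, the map
so obtained, composed with the Polish representation, is the given coordinate. -/

/-- Continuous homomorphisms on a free profinite algebra are determined by the generators. -/
theorem FreeProfinite.hom_ext {Sg : ℕ → Type u} [∀ n, TopologicalSpace (Sg n)] {X : Type v}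
    [TopologicalSpace X] {T : Type w} [TopologicalSpace T] [T2Space T] [Alg Sg T]
    {f g : FreeProfinite Sg X → T} (hf : Continuous f) (hg : Continuous g)
    (hf' : IsHom Sg f) (hg' : IsHom Sg g) (h : ∀ x, f (ι Sg X x) = g (ι Sg X x)) : f = g := by
  -- The equaliser of `f` and `g` is a subalgebra, closed because `T` is Hausdorff, and it contains
  -- the generators.
  refine funext fun y => mem_of_isClosed {y | f y = g y} (isClosed_eq hf hg) ?_ h y
  intro n c s hs
  change f _ = g _
  rw [hf', hg']
  exact congrArg _ (funext hs)

/-! ### The action of Polish words on a finite algebra -/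

/-- For an at most unary signature, every finite algebra `T` under `X` is a quotient of the
algebra of Polish words: words act on `T`, the letters of `X` and the constants acting by
constant maps, and are then evaluated at an arbitrary point. -/
theorem exists_hom_polishAlgebra {Sg : ℕ → Type u} [∀ n, TopologicalSpace (Sg n)]
    (hSg : ∀ n, 2 ≤ n → IsEmpty (Sg n)) {X : Type v} [TopologicalSpace X]
    {T : Type} [Finite T] [TopologicalSpace T] [DiscreteTopology T] [Alg Sg T]
    (hT : ContinuousEval Sg T) (t₀ : T) {φ : X → T} (hφ : Continuous φ) :
    ∃ g : PolishAlgebra Sg X → T, Continuous g ∧ IsHom Sg g ∧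
      ∀ x, g (polishLetter Sg X x) = φ x := by
  -- The product topology on self-maps is discrete since `T` is finite and discrete.
  let _ : TopologicalSpace (Function.End T) := inferInstanceAs (TopologicalSpace (T → T))
  have : DiscreteTopology (Function.End T) := inferInstanceAs (DiscreteTopology (T → T))
  have : Finite (Function.End T) := inferInstanceAs (Finite (T → T))
  -- Feeding `t` into every argument treats all arities at once: a constant map for arity 0, the
  -- operation itself for arity 1. Arities from 2 on have no symbols.
  let α : Alphabet Sg X → Function.End T :=
    Sum.elim (fun x _ => φ x) (fun p t => Alg.eval p.1 p.2 fun _ => t)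
  have hα : Continuous α := by
    -- Continuity into the product is checked at each `t` separately, on each summand of the
    -- alphabet; for symbols it is continuity of the evaluation map in its first variable.
    refine Continuous.sumElim (continuous_pi fun _ => hφ)
      (continuous_pi fun t => continuous_sigma fun n => ?_)
    exact (hT n).comp (f := fun c : Sg n => (c, fun _ => t)) (by fun_prop)
  obtain ⟨f, hf, hfα⟩ := FreeProfiniteMonoid.exists_hom_finite α hα
  have heval : Continuous fun h : Function.End T => h t₀ := continuous_of_discreteTopology
  refine ⟨fun m => f m.1 t₀, heval.comp (hf.comp continuous_subtype_val), fun n c s => ?_,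
    fun x => congrFun (hfα (Sum.inl x)) t₀⟩
  change f (FreeProfiniteMonoid.η _ (Sum.inr ⟨n, c⟩) *
    (List.ofFn fun j => (s j : FreeProfiniteMonoid (Alphabet Sg X))).prod) t₀ = _
  rw [map_mul, hfα]
  -- Multiplication in `Function.End T` is composition, so the symbol acts on the value at `t₀` of
  -- the product of all arguments. It remains to compare this value with that of the single argument
  -- `s j`.
  change (Alg.eval n c fun _ => f _ t₀) = _
  refine congrArg _ (funext fun j => ?_)
  -- Arity 0 offers no index `j`; in arity 1 the product has the single factor `s 0`.
  match n, c, s, j with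
  | 1, _, s, j => simp [Subsingleton.elim j 0]
  | n + 2, c, _, _ => exact ((hSg (n + 2) (by omega)).false c).elim

/-! ### The Polish representation is a continuous bijection -/

variable (Sg : ℕ → Type u) [∀ n, TopologicalSpace (Sg n)] (X : Type v) [TopologicalSpace X]

theorem continuous_polishRepresentation : Continuous (polishRepresentation Sg X) :=
  (FreeProfinite.lift_spec _ _ _).1

theorem isHom_polishRepresentation : IsHom Sg (polishRepresentation Sg X) :=
  (FreeProfinite.lift_spec _ _ _).2.1

theorem polishRepresentation_ι (x : X) :
    polishRepresentation Sg X (FreeProfinite.ι Sg X x) = polishLetter Sg X x :=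
  (FreeProfinite.lift_spec _ _ _).2.2 x

/-- The range is closed, being compact in a Hausdorff space; it is also a subalgebra containing the
letters, so it exhausts the closed subalgebra they generate. No bound on the arities is involved. -/
theorem surjective_polishRepresentation : Function.Surjective (polishRepresentation Sg X) := by
  have := (FreeProfinite.isProfinite Sg X).compact
  have := (isProfinite_polishAlgebra Sg X).t2
  refine fun z => mem_of_closedSubalgebra (range (polishRepresentation Sg X))
    (isCompact_range (continuous_polishRepresentation Sg X)).isClosed ?_ ?_ z
  · intro n c s hs
    choose t ht using hs
    exact ⟨Alg.eval n c t, (isHom_polishRepresentation Sg X n c t).trans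
      (congrArg _ (funext ht))⟩
  · rintro _ ⟨x, rfl⟩
    exact ⟨_, polishRepresentation_ι Sg X x⟩

/-- The free profinite algebra sits inside a product of finite algebras, so it is enough that points
with the same image agree in every coordinate; this follows once each coordinate is a function of
the image. -/
theorem injective_polishRepresentation (hSg : ∀ n, 2 ≤ n → IsEmpty (Sg n)) :
    Function.Injective (polishRepresentation Sg X) := by
  intro y y' h
  refine Subtype.ext (funext fun i => ?_)
  -- Any point of the finite algebra can serve as the point of evaluation; `FreeProfinite.coord i y`
  -- is one at hand.
  obtain ⟨g, hg, hg', hgx⟩ := exists_hom_polishAlgebra hSg i.continuousEval_carrier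
    (FreeProfinite.coord i y) (φ := fun x => (i.map x : i.Carrier)) i.continuous_map
  -- Both sides are continuous homomorphisms taking the generator `x` to `i.map x`.
  have key : FreeProfinite.coord i = fun z => g (polishRepresentation Sg X z) := by
    refine FreeProfinite.hom_ext (FreeProfinite.continuous_coord i)
      (hg.comp (continuous_polishRepresentation Sg X)) (FreeProfinite.isHom_coord i) ?_ ?_
    · intro n c s
      exact (congrArg g (isHom_polishRepresentation Sg X n c s)).trans (hg' n c _)
    · intro x
      rw [polishRepresentation_ι, hgx]
      rfl
  change FreeProfinite.coord i y = FreeProfinite.coord i y'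
  rw [key]
  exact congrArg g h

end UnivAlg

theorem theorem7p4 (Sg : ℕ → Type u) [∀ n, TopologicalSpace (Sg n)]
    (hSg : ∀ n, 2 ≤ n → IsEmpty (Sg n)) (X : Type v) [TopologicalSpace X] :
    UnivAlg.IsTopAlgIso Sg (UnivAlg.polishRepresentation Sg X) := by
  have := (UnivAlg.FreeProfinite.isProfinite Sg X).compact
  have := (UnivAlg.isProfinite_polishAlgebra Sg X).t2
  exact ⟨UnivAlg.isHom_polishRepresentation Sg X, isHomeomorph_iff_continuous_bijective.mpr
    ⟨UnivAlg.continuous_polishRepresentation Sg X,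
      UnivAlg.injective_polishRepresentation Sg X hSg,
      UnivAlg.surjective_polishRepresentation Sg X⟩⟩
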